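/- Let $R$ be a commutative ring with unit and let $(M,q)$ be a quadratic module over $R$: $M$ is a finitely generated projective $R$-module and $q:M\to R$ is a quadratic form, with associated bilinear form $(x,y)=q(x+y)-q(x)-q(y)$. Let $\mathcal{C}=\mathcal{C}(M,q)$ be the Clifford algebra (with $x^{2}=q(x)$ for $x\in M$), and let $\alpha\mapsto\alpha'$ be its grade involution, the algebra automorphism with $x'=-x$ for $x\in M$. Put $M_{R}=R\oplus M\subseteq\mathcal{C}$, with the quadratic form $q_{R}(a+x)=q(x)-a^{2}$, let $M_{R}^{\perp}$ be the kernel of the bilinear form of $q_{R}$, and let $\operatorname{O}_{M_{R}^{\perp}}(M_{R},q_{R})$ be the group of invertible isometries of $(M_{R},q_{R})$ that act trivially on $M_{R}^{\perp}$. The paravector Clifford group is \[\widetilde{\Gamma}(M,q)=\{\alpha\in\mathcal{C}^{\times}\mid \alpha\xi\alpha'^{-1}\in R\oplus M\text{ and }\alpha^{-1}\xi\alpha'\in R\oplus M\text{ for all }\xi\in R\oplus M\},\] and $\widetilde{\pi}:\widetilde{\Gamma}(M,q)\to\operatorname{O}_{M_{R}^{\perp}}(M_{R},q_{R})$ is the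 group homomorphism given by $\widetilde{\pi}(\alpha)(\xi)=\alpha\xi\alpha'^{-1}$. Let $e\in R$ be an idempotent with $e\neq0$, so that $eR$ is a non-zero commutative ring with unit $e$, and $q$ restricts to a quadratic form $eq$ on the $eR$-module $eM$. Let $r_{e}$ be the $e$-reflection of $(M_{R},q_{R})$ associated with the vector $e\in eM_{R}$, i.e., $r_{e}(\eta)=\eta-\frac{(e,\eta)_{R}}{q_{R}(e)}e$, where the division is in $eR$; explicitly, $r_{e}(a+x)=(1-2e)a+x$ for $a\in R$ and $x\in M$. Assume that $eR$ is contained in a commutative ring $S$ (with unit $e$), such that the scalar extension $\big((eM)_{S},(eq)_{S}\big)$ of the quadratic module $(eM,eq)$ over $eR$ to $S$ admits a finite $S$-basis $\{x_{i}\}_{i=1}^{n}$ that is orthogonal for the bilinear form of $(eq)_{S}$. Assume further that $2$ is not a zero-divisor in $S$, and that each value $(eq)_{S}(x_{i})$ that is non-zero is not a zero-divisor in $S$. Then $r_{e}$ is not in the image of $\widetilde{\pi}$, i.e., there is no $\alpha\in\widetilde{\Gamma}(M,q)$ with $\widetilde{\pi}(\alpha)=r_{e}$. -/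

import Mathlib

open scoped TensorProduct

noncomputable section

namespace QuadMod

/-! ### Quadratic modules: kernel, bilinear representatives, extension of scalars -/

section General

variable {R : Type*} [CommRing R] {M : Type*} [AddCommGroup M] [Module R M]

/-- The kernel `M^⊥` of the symmetric bilinear form `(x, y) = q (x + y) - q x - q y`
attached to the quadratic form `q`. -/
def kernel (q : QuadraticForm R M) : Submodule R M :=
  LinearMap.ker (QuadraticMap.polarBilin q)

theorem mem_kernel {q : QuadraticForm R M} {x : M} :
    x ∈ kernel q ↔ ∀ y, QuadraticMap.polar q x y = 0 := by
  simp [kernel, LinearMap.ext_iff]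

/-- On a projective module every quadratic form is `x ↦ B x x` for some (not necessarily symmetric)
bilinear form `B`. -/
theorem exists_bilinForm [Module.Projective R M] (q : QuadraticForm R M) :
    ∃ B : LinearMap.BilinForm R M, LinearMap.BilinMap.toQuadraticMap B = q := by
  obtain ⟨s, hs⟩ := Module.projective_def'.mp (inferInstance : Module.Projective R M)
  obtain ⟨B, hB⟩ := LinearMap.BilinMap.toQuadraticMap_surjective
    (q.comp (Finsupp.linearCombination R (id : M → M)))
  refine ⟨B.compl₁₂ s s, ?_⟩
  ext x
  have h1 := congrArg (fun f => f (s x)) hB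
  have h2 := LinearMap.congr_fun hs x
  simp only [LinearMap.comp_apply, LinearMap.id_apply] at h2
  simpa [h2] using h1

variable (S : Type*) [CommRing S] [Algebra R S]

/-- The extension of scalars `q_S` of a quadratic form `q` on a projective module: it is
`z ↦ B_S z z`, where `B` is any bilinear form with `q x = B x x`. It is independent of the choice
of `B`: see `extend_tmul`, `polar_extend_tmul` and `extend_unique`. -/
def extend [Module.Projective R M] (q : QuadraticForm R M) : QuadraticForm S (S ⊗[R] M) :=
  LinearMap.BilinMap.toQuadraticMap
    (LinearMap.BilinForm.baseChange S (Classical.choose (exists_bilinForm q)))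

theorem extend_tmul [Module.Projective R M] (q : QuadraticForm R M) (s : S) (x : M) :
    extend S q (s ⊗ₜ x) = s ^ 2 * algebraMap R S (q x) := by
  conv_rhs => rw [← Classical.choose_spec (exists_bilinForm q)]
  simp [extend, LinearMap.BilinMap.toQuadraticMap_apply, LinearMap.BilinForm.baseChange_tmul,
    Algebra.smul_def, mul_comm, sq]

theorem polar_extend_tmul [Module.Projective R M] (q : QuadraticForm R M) (s t : S) (x y : M) :
    QuadraticMap.polar (extend S q) (s ⊗ₜ x) (t ⊗ₜ y) =
      s * t * algebraMap R S (QuadraticMap.polar q x y) := by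
  have h := Classical.choose_spec (exists_bilinForm q)
  conv_rhs => rw [← h]
  simp only [extend, LinearMap.BilinMap.polar_toQuadraticMap,
    LinearMap.BilinForm.baseChange_tmul, Algebra.smul_def, map_add]
  ring

/-- The extension of scalars is the unique quadratic form with the expected values on pure tensors
and the expected pairings of pure tensors. -/
theorem extend_unique [Module.Projective R M] (q : QuadraticForm R M)
    (Q : QuadraticForm S (S ⊗[R] M))
    (h1 : ∀ (s : S) (x : M), Q (s ⊗ₜ x) = s ^ 2 * algebraMap R S (q x))
    (h2 : ∀ (s t : S) (x y : M), QuadraticMap.polar Q (s ⊗ₜ x) (t ⊗ₜ y) =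
      s * t * algebraMap R S (QuadraticMap.polar q x y)) :
    Q = extend S q := by
  have hp : QuadraticMap.polarBilin Q = QuadraticMap.polarBilin (extend S q) := by
    refine LinearMap.ext fun z => LinearMap.ext fun w => ?_
    simp only [QuadraticMap.polarBilin_apply_apply]
    induction z with
    | zero => simp
    | add a b ha hb => rw [QuadraticMap.polar_add_left, QuadraticMap.polar_add_left, ha, hb]
    | tmul s x =>
      induction w with
      | zero => simp
      | add a b ha hb => rw [QuadraticMap.polar_add_right, QuadraticMap.polar_add_right, ha, hb]
      | tmul t y => rw [h2, polar_extend_tmul]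
  refine QuadraticMap.ext fun z => ?_
  induction z with
  | zero => simp
  | add a b ha hb =>
    rw [QuadraticMap.map_add Q, QuadraticMap.map_add (extend S q), ha, hb]
    congr 1
    exact LinearMap.congr_fun (LinearMap.congr_fun hp a) b
  | tmul s x => rw [h1, extend_tmul]

end General

/-! ### Orthogonal groups -/

section Orthogonal

variable {R : Type*} [CommRing R] {M : Type*} [AddCommGroup M] [Module R M]

/-- The group `O(M, q)` of invertible isometries of `(M, q)`. -/
def orthogonalGroup (q : QuadraticForm R M) : Subgroup (M ≃ₗ[R] M) where
  carrier := {φ | ∀ x, q (φ x) = q x}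
  one_mem' := fun _ => rfl
  mul_mem' := fun {φ ψ} hφ hψ x => by
    rw [LinearEquiv.mul_apply, hφ, hψ]
  inv_mem' := fun {φ} hφ x => by
    have h := hφ (φ⁻¹ x)
    rw [← LinearEquiv.mul_apply, mul_inv_cancel, LinearEquiv.coe_one, id] at h
    exact h.symm

/-- The group `O_{M^⊥}(M, q)` of those elements of `O(M, q)` that act trivially on `M^⊥`. -/
def orthogonalGroupKernel (q : QuadraticForm R M) : Subgroup (M ≃ₗ[R] M) where
  carrier := {φ | φ ∈ orthogonalGroup q ∧ ∀ x ∈ kernel q, φ x = x}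
  one_mem' := ⟨one_mem _, fun _ _ => rfl⟩
  mul_mem' := fun {φ ψ} hφ hψ => ⟨mul_mem hφ.1 hψ.1, fun x hx => by
    rw [LinearEquiv.mul_apply, hψ.2 x hx, hφ.2 x hx]⟩
  inv_mem' := fun {φ} hφ => ⟨inv_mem hφ.1, fun x hx => by
    conv_lhs => rw [← hφ.2 x hx]
    rw [← LinearEquiv.mul_apply, inv_mul_cancel, LinearEquiv.coe_one, id]⟩

end Orthogonal

/-! ### The part cut out by an idempotent, and `e`-reflections -/

section Idempotent

variable {R : Type*} [CommRing R] {e : R}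
variable {M : Type*} [AddCommGroup M] [Module R M]

/-- The submodule `eM = {e x | x ∈ M}` of `M`. -/
def idemPart (e : R) (M : Type*) [AddCommGroup M] [Module R M] : Submodule R M :=
  LinearMap.range (LinearMap.lsmul R M e)

/-- Elements of the ring `eR` are elements of `R`. -/
instance cornerCoe (he : IsIdempotentElem e) : CoeOut he.Corner R := ⟨fun r => r.1⟩

theorem smul_of_mem_idemPart (he : IsIdempotentElem e) {x : M} (hx : x ∈ idemPart e M) :
    e • x = x := by
  obtain ⟨y, rfl⟩ := hx
  simp [smul_smul, he.eq]

theorem smul_mem_idemPart (r : R) (x : M) : (e * r) • x ∈ idemPart e M :=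
  ⟨r • x, by simp [mul_smul, smul_comm e r x]⟩

theorem corner_mul (he : IsIdempotentElem e) (r : he.Corner) : e * (r : R) = r :=
  ((Subsemigroup.mem_corner_iff he).mp r.2).1

theorem mem_corner_of_mul (he : IsIdempotentElem e) {r : R} (h : e * r = r) :
    r ∈ Subsemigroup.corner e :=
  (Subsemigroup.mem_corner_iff he).mpr ⟨h, by rw [mul_comm, h]⟩

@[simp] theorem corner_coe_one (he : IsIdempotentElem e) : ((1 : he.Corner) : R) = e := rfl

@[simp] theorem corner_coe_mul (he : IsIdempotentElem e) (r s : he.Corner) :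
    ((r * s : he.Corner) : R) = r * s := rfl

@[simp] theorem corner_coe_add (he : IsIdempotentElem e) (r s : he.Corner) :
    ((r + s : he.Corner) : R) = r + s := rfl

@[simp] theorem corner_coe_zero (he : IsIdempotentElem e) : ((0 : he.Corner) : R) = 0 := rfl

/-- `eM` is a module over the ring `eR` (whose unit element is `e`). -/
instance idemPartModule (he : IsIdempotentElem e) : Module he.Corner (idemPart e M) where
  smul r x := ⟨(r : R) • (x : M), (idemPart e M).smul_mem _ x.2⟩
  one_smul x := Subtype.ext (smul_of_mem_idemPart he x.2)
  mul_smul r s x := Subtype.ext (mul_smul (r : R) (s : R) (x : M))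
  smul_zero r := Subtype.ext (smul_zero (r : R))
  smul_add r x y := Subtype.ext (smul_add (r : R) (x : M) (y : M))
  add_smul r s x := Subtype.ext (add_smul (r : R) (s : R) (x : M))
  zero_smul x := Subtype.ext (zero_smul R (x : M))

@[simp] theorem idemPart_coe_smul (he : IsIdempotentElem e) (r : he.Corner) (x : idemPart e M) :
    ((r • x : idemPart e M) : M) = (r : R) • (x : M) := rfl

/-- The projection `r ↦ e r` of `R` onto the ring `eR`. -/
def toCorner (he : IsIdempotentElem e) : R →+* he.Corner where
  toFun r := ⟨e * r, mem_corner_of_mul he (by rw [← mul_assoc, he.eq])⟩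
  map_one' := Subtype.ext (mul_one e)
  map_mul' r s := Subtype.ext (by
    change e * (r * s) = e * r * (e * s)
    rw [mul_mul_mul_comm, he.eq])
  map_zero' := Subtype.ext (mul_zero e)
  map_add' r s := Subtype.ext (mul_add e r s)

@[simp] theorem coe_toCorner (he : IsIdempotentElem e) (r : R) : (toCorner he r : R) = e * r := rfl

/-- If `M` is projective over `R` then `eM` is projective over `eR`. -/
instance idemPart_projective (he : IsIdempotentElem e) [Module.Projective R M] :
    Module.Projective he.Corner (idemPart e M) := by
  let _ : Algebra R he.Corner := (toCorner he).toAlgebra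
  have hsm : ∀ (r : R) (c : he.Corner), ((r • c : he.Corner) : R) = r * c := fun r c => by
    rw [Algebra.smul_def]
    change e * r * (c : R) = r * c
    rw [mul_comm e r, mul_assoc, corner_mul]
  have : IsScalarTower R he.Corner (idemPart e M) := ⟨fun r c x => Subtype.ext (by
    rw [idemPart_coe_smul, hsm, Submodule.coe_smul, idemPart_coe_smul, mul_smul])⟩
  let i : idemPart e M →ₗ[he.Corner] he.Corner ⊗[R] M :=
    { toFun := fun x => 1 ⊗ₜ (x : M)
      map_add' := fun x y => by simp [TensorProduct.tmul_add]
      map_smul' := fun r x => by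
        have : r = (r : R) • (1 : he.Corner) := Subtype.ext (by
          rw [hsm, corner_coe_one, mul_comm, corner_mul])
        rw [RingHom.id_apply, idemPart_coe_smul, ← TensorProduct.smul_tmul, ← this,
          TensorProduct.smul_tmul', smul_eq_mul, mul_one] }
  let f : M →ₗ[R] idemPart e M := LinearMap.rangeRestrict (LinearMap.lsmul R M e)
  let p : he.Corner ⊗[R] M →ₗ[he.Corner] idemPart e M :=
    LinearMap.liftBaseChange he.Corner f
  refine Module.Projective.of_split i p (LinearMap.ext fun x => Subtype.ext ?_)
  have hp : p (i x) = (1 : he.Corner) • f (x : M) :=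
    LinearMap.liftBaseChange_tmul _ _ _ _
  rw [LinearMap.comp_apply, hp]
  change ((1 : he.Corner) : R) • (e • (x : M)) = x
  rw [corner_coe_one, smul_of_mem_idemPart he x.2, smul_of_mem_idemPart he x.2]

theorem apply_mem_corner (he : IsIdempotentElem e) (q : QuadraticForm R M) (x : idemPart e M) :
    q x ∈ Subsemigroup.corner e := by
  refine mem_corner_of_mul he ?_
  conv_rhs => rw [← smul_of_mem_idemPart he x.2]
  rw [QuadraticMap.map_smul, he.eq, smul_eq_mul]

theorem mul_polar (he : IsIdempotentElem e) (q : QuadraticForm R M) {x : M}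
    (hx : x ∈ idemPart e M) (y : M) :
    e * QuadraticMap.polar q x y = QuadraticMap.polar q x y := by
  conv_rhs => rw [← smul_of_mem_idemPart he hx]
  rw [QuadraticMap.polar_smul_left, smul_eq_mul]

/-- The restriction `eq` of `q` to `eM`, as a quadratic form over the ring `eR`. -/
def idemForm (he : IsIdempotentElem e) (q : QuadraticForm R M) :
    QuadraticForm he.Corner (idemPart e M) where
  toFun x := ⟨q x, apply_mem_corner he q x⟩
  toFun_smul r x := Subtype.ext (QuadraticMap.map_smul q (r : R) (x : M))
  exists_companion' :=
    ⟨LinearMap.mk₂ he.Corner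
      (fun x y => ⟨QuadraticMap.polar q x y, mem_corner_of_mul he (mul_polar he q x.2 y)⟩)
      (fun x y z => Subtype.ext (QuadraticMap.polar_add_left q (x : M) y z))
      (fun r x y => Subtype.ext (QuadraticMap.polar_smul_left q (r : R) (x : M) y))
      (fun x y z => Subtype.ext (QuadraticMap.polar_add_right q (x : M) y z))
      (fun r x y => Subtype.ext (QuadraticMap.polar_smul_right q (r : R) (x : M) y)),
    fun x y => Subtype.ext (QuadraticMap.map_add q (x : M) y)⟩

@[simp] theorem coe_idemForm (he : IsIdempotentElem e) (q : QuadraticForm R M)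
    (x : idemPart e M) : (idemForm he q x : R) = q x := rfl

/-- The map `y ↦ y - ((x, y) / q x) x` for `x ∈ eM` such that `q x` is a unit of the ring `eR`;
the division is multiplication by the inverse of `q x` in `eR`. -/
def eReflectionMap (he : IsIdempotentElem e) (q : QuadraticForm R M) (x : idemPart e M)
    (hx : IsUnit (idemForm he q x)) : M →ₗ[R] M where
  toFun y := y - (((hx.unit⁻¹ : he.Cornerˣ) : he.Corner) * QuadraticMap.polar q x y : R) • (x : M)
  map_add' y z := by
    rw [QuadraticMap.polar_add_right, mul_add, add_smul]; abel
  map_smul' r y := by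
    rw [QuadraticMap.polar_smul_right, RingHom.id_apply, smul_sub, smul_smul, smul_eq_mul,
      mul_left_comm]

theorem eReflectionMap_apply (he : IsIdempotentElem e) (q : QuadraticForm R M) (x : idemPart e M)
    (hx : IsUnit (idemForm he q x)) (y : M) :
    eReflectionMap he q x hx y =
      y - (((hx.unit⁻¹ : he.Cornerˣ) : he.Corner) * QuadraticMap.polar q x y : R) • (x : M) := rfl

theorem inv_mul_apply (he : IsIdempotentElem e) (q : QuadraticForm R M) (x : idemPart e M)
    (hx : IsUnit (idemForm he q x)) :
    (((hx.unit⁻¹ : he.Cornerˣ) : he.Corner) : R) * q x = e :=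
  congrArg Subtype.val (hx.val_inv_mul)

theorem eReflectionMap_involutive (he : IsIdempotentElem e) (q : QuadraticForm R M)
    (x : idemPart e M) (hx : IsUnit (idemForm he q x)) :
    Function.Involutive (eReflectionMap he q x hx) := fun y => by
  have h1 := inv_mul_apply he q x hx
  have h2 := mul_polar he q x.2 y
  simp only [eReflectionMap_apply]
  generalize (((hx.unit⁻¹ : he.Cornerˣ) : he.Corner) : R) = w at *
  have h3 : w * QuadraticMap.polar q x (y - (w * QuadraticMap.polar q x y) • (x : M)) =
      - (w * QuadraticMap.polar q x y) := by
    rw [QuadraticMap.polar_sub_right, QuadraticMap.polar_smul_right, QuadraticMap.polar_self,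
      smul_eq_mul, two_nsmul]
    linear_combination (-2 * w * QuadraticMap.polar q x y) * h1 - 2 * w * h2
  rw [h3, neg_smul, sub_neg_eq_add, sub_add_cancel]

/-- The `e`-reflection `r_x`, as an element of `O_{M^⊥}(M, q)`. -/
def eReflection (he : IsIdempotentElem e) (q : QuadraticForm R M) (x : idemPart e M)
    (hx : IsUnit (idemForm he q x)) : orthogonalGroupKernel q :=
  ⟨LinearEquiv.ofInvolutive (eReflectionMap he q x hx) (eReflectionMap_involutive he q x hx), by
    refine ⟨fun y => ?_, fun y hy => ?_⟩
    · change q (eReflectionMap he q x hx y) = q y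
      have h1 := inv_mul_apply he q x hx
      have h2 := mul_polar he q x.2 y
      rw [eReflectionMap_apply]
      generalize (((hx.unit⁻¹ : he.Cornerˣ) : he.Corner) : R) = w at *
      rw [sub_eq_add_neg, ← neg_smul, QuadraticMap.map_add q, QuadraticMap.map_smul,
        QuadraticMap.polar_smul_right, QuadraticMap.polar_comm q y, smul_eq_mul, smul_eq_mul]
      linear_combination (w * QuadraticMap.polar q x y ^ 2) * h1 +
        w * QuadraticMap.polar q x y * h2
    · change eReflectionMap he q x hx y = y
      rw [eReflectionMap_apply, QuadraticMap.polar_comm, mem_kernel.mp hy, mul_zero, zero_smul,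
        sub_zero]⟩

end Idempotent

/-! ### Paravectors and the paravector Clifford group -/

section Paravector

variable {R : Type*} [CommRing R] {M : Type*} [AddCommGroup M] [Module R M]

/-- The quadratic form `q_R (a + x) = q x - a ^ 2` on `M_R = R ⊕ M`. -/
def paraForm (q : QuadraticForm R M) : QuadraticForm R (R × M) :=
  QuadraticMap.prod (-QuadraticMap.sq) q

theorem paraForm_apply (q : QuadraticForm R M) (a : R) (x : M) :
    paraForm q (a, x) = q x - a ^ 2 := by
  simp [paraForm, sq]; ring

theorem polar_paraForm (q : QuadraticForm R M) (ξ η : R × M) :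
    QuadraticMap.polar (paraForm q) ξ η =
      QuadraticMap.polar q ξ.2 η.2 - 2 * ξ.1 * η.1 := by
  obtain ⟨a, x⟩ := ξ
  obtain ⟨b, y⟩ := η
  simp only [QuadraticMap.polar, Prod.mk_add_mk, paraForm_apply]
  ring

/-- The map `R ⊕ M → 𝒞(M, q)`, `a + x ↦ a + x`, whose image consists of the paravectors. -/
def para (q : QuadraticForm R M) : R × M →ₗ[R] CliffordAlgebra q :=
  LinearMap.coprod (Algebra.linearMap R (CliffordAlgebra q)) (CliffordAlgebra.ι q)

theorem para_apply (q : QuadraticForm R M) (ξ : R × M) :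
    para q ξ = algebraMap R (CliffordAlgebra q) ξ.1 + CliffordAlgebra.ι q ξ.2 := by
  simp [para]

theorem para_injective (q : QuadraticForm R M) [Module.Projective R M] :
    Function.Injective (para q) := by
  obtain ⟨B, hB⟩ := exists_bilinForm q
  rw [injective_iff_map_eq_zero]
  intro ξ h
  have hB' : LinearMap.BilinMap.toQuadraticMap (-B) = (0 : QuadraticForm R M) - q := by
    rw [LinearMap.BilinMap.toQuadraticMap_neg, hB, zero_sub]
  have h' := congrArg (CliffordAlgebra.changeForm hB') h
  rw [para_apply, map_add, CliffordAlgebra.changeForm_algebraMap, CliffordAlgebra.changeForm_ι,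
    map_zero] at h'
  have h3 : ExteriorAlgebra.ι R ξ.2 = algebraMap R (ExteriorAlgebra R M) (-ξ.1) := by
    rw [map_neg]
    exact (neg_eq_of_add_eq_zero_right h').symm
  obtain ⟨h4, h5⟩ := (ExteriorAlgebra.ι_eq_algebraMap_iff _ _).mp h3
  exact Prod.ext (neg_eq_zero.mp h5) h4

theorem algebraMap_injective (q : QuadraticForm R M) [Module.Projective R M] :
    Function.Injective (algebraMap R (CliffordAlgebra q)) := fun a b h => by
  have := @para_injective R _ M _ _ q _ (a, 0) (b, 0) (by simpa [para_apply] using h)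
  exact congrArg Prod.fst this

/-- The paravectors of `𝒞(M, q)`: the elements of `R ⊕ M ⊆ 𝒞(M, q)`. -/
def paravectors (q : QuadraticForm R M) : Submodule R (CliffordAlgebra q) :=
  LinearMap.range (para q)

/-- The grade involution `α ↦ α'` on the group of units of the Clifford algebra. -/
def gradeInv (q : QuadraticForm R M) : (CliffordAlgebra q)ˣ →* (CliffordAlgebra q)ˣ :=
  Units.map (CliffordAlgebra.involute (Q := q) : CliffordAlgebra q →* CliffordAlgebra q)

@[simp] theorem coe_gradeInv (q : QuadraticForm R M) (α : (CliffordAlgebra q)ˣ) :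
    (gradeInv q α : CliffordAlgebra q) = CliffordAlgebra.involute (α : CliffordAlgebra q) := rfl

/-- The paravector Clifford group: the units `α` of `𝒞(M, q)` such that `α ξ α'⁻¹` and
`α⁻¹ ξ α'` are paravectors for every paravector `ξ`. -/
def paraCliffordGroup (q : QuadraticForm R M) : Subgroup (CliffordAlgebra q)ˣ where
  carrier := {α | ∀ ξ ∈ paravectors q,
    (α : CliffordAlgebra q) * ξ * ((gradeInv q α)⁻¹ : (CliffordAlgebra q)ˣ) ∈ paravectors q ∧
    ((α⁻¹ : (CliffordAlgebra q)ˣ) : CliffordAlgebra q) * ξ * gradeInv q α ∈ paravectors q}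
  one_mem' := fun ξ hξ => by simpa using hξ
  mul_mem' := fun {α β} hα hβ ξ hξ => by
    have h1 := (hα _ (hβ ξ hξ).1).1
    have h2 := (hβ _ (hα ξ hξ).2).2
    simp only [map_mul, mul_inv_rev, Units.val_mul, mul_assoc] at h1 h2 ⊢
    exact ⟨h1, h2⟩
  inv_mem' := fun {α} hα ξ hξ => by
    have h := hα ξ hξ
    rw [map_inv, inv_inv, inv_inv]
    exact ⟨h.2, h.1⟩

/-- The action `ξ ↦ α ξ α'⁻¹` on `R ⊕ M` of an element `α` of the paravector Clifford group. -/
def twistedConj (q : QuadraticForm R M) [Module.Projective R M] (α : paraCliffordGroup q) :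
    R × M →ₗ[R] R × M :=
  (LinearEquiv.ofInjective (para q) (para_injective q)).symm.toLinearMap ∘ₗ
    LinearMap.codRestrict (paravectors q)
      (LinearMap.mulLeftRight R
        ((α : (CliffordAlgebra q)ˣ), ((gradeInv q α)⁻¹ : (CliffordAlgebra q)ˣ)) ∘ₗ para q)
      (fun ξ => (α.2 _ ⟨ξ, rfl⟩).1)

theorem para_twistedConj (q : QuadraticForm R M) [Module.Projective R M]
    (α : paraCliffordGroup q) (ξ : R × M) :
    para q (twistedConj q α ξ) =
      (α : (CliffordAlgebra q)ˣ) * para q ξ * ((gradeInv q α)⁻¹ : (CliffordAlgebra q)ˣ) := by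
  have h := congrArg Subtype.val ((LinearEquiv.ofInjective (para q) (para_injective q)).apply_symm_apply
    (LinearMap.codRestrict (paravectors q)
      (LinearMap.mulLeftRight R
        ((α : (CliffordAlgebra q)ˣ), ((gradeInv q α)⁻¹ : (CliffordAlgebra q)ˣ)) ∘ₗ para q)
      (fun ξ => (α.2 _ ⟨ξ, rfl⟩).1) ξ))
  exact h

theorem twistedConj_one (q : QuadraticForm R M) [Module.Projective R M] :
    twistedConj q 1 = LinearMap.id := by
  refine LinearMap.ext fun ξ => para_injective q ?_
  rw [para_twistedConj]
  simp

theorem twistedConj_mul (q : QuadraticForm R M) [Module.Projective R M]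
    (α β : paraCliffordGroup q) :
    twistedConj q (α * β) = twistedConj q α ∘ₗ twistedConj q β := by
  refine LinearMap.ext fun ξ => para_injective q ?_
  rw [LinearMap.comp_apply, para_twistedConj, para_twistedConj, para_twistedConj]
  simp only [Subgroup.coe_mul, map_mul, mul_inv_rev, Units.val_mul, mul_assoc]

/-- The action of an element of the paravector Clifford group, as an invertible map. -/
def twistedConjEquiv (q : QuadraticForm R M) [Module.Projective R M] (α : paraCliffordGroup q) :
    (R × M) ≃ₗ[R] (R × M) :=
  LinearEquiv.ofLinearMap (twistedConj q α) (twistedConj q α⁻¹)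
    (by rw [← twistedConj_mul, mul_inv_cancel, twistedConj_one])
    (by rw [← twistedConj_mul, inv_mul_cancel, twistedConj_one])

theorem para_mul_involute (q : QuadraticForm R M) (ξ : R × M) :
    para q ξ * CliffordAlgebra.involute (para q ξ) =
      -algebraMap R (CliffordAlgebra q) (paraForm q ξ) := by
  obtain ⟨a, x⟩ := ξ
  rw [paraForm_apply, para_apply]
  simp only [map_add, AlgHom.commutes, CliffordAlgebra.involute_ι, map_sub, map_pow]
  have h := Algebra.commutes a (CliffordAlgebra.ι q x)
  rw [← CliffordAlgebra.ι_sq_scalar]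
  simp only [add_mul, mul_add, mul_neg, h, sq]
  abel

theorem para_mul_of_mem_kernel (q : QuadraticForm R M) {ξ : R × M} (hξ : ξ ∈ kernel (paraForm q))
    (β : CliffordAlgebra q) :
    para q ξ * β = CliffordAlgebra.involute β * para q ξ := by
  induction β using CliffordAlgebra.induction with
  | algebraMap r => rw [AlgHom.commutes, Algebra.commutes]
  | ι m =>
    have h1 := mem_kernel.mp hξ (1, 0)
    have h2 := mem_kernel.mp hξ (0, m)
    rw [polar_paraForm] at h1 h2
    simp only [QuadraticMap.polar_zero_right, mul_one, mul_zero, sub_zero, zero_sub,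
      neg_eq_zero] at h1 h2
    have h3 := CliffordAlgebra.ι_mul_ι_add_swap (Q := q) ξ.2 m
    rw [h2, map_zero] at h3
    have h4 : algebraMap R (CliffordAlgebra q) ξ.1 * CliffordAlgebra.ι q m +
        algebraMap R (CliffordAlgebra q) ξ.1 * CliffordAlgebra.ι q m = 0 := by
      rw [← add_mul, ← map_add, ← two_mul, h1, map_zero, zero_mul]
    rw [CliffordAlgebra.involute_ι, para_apply, add_mul, neg_mul, mul_add,
      ← Algebra.commutes ξ.1 (CliffordAlgebra.ι q m), eq_neg_iff_add_eq_zero]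
    calc _ = (algebraMap R (CliffordAlgebra q) ξ.1 * CliffordAlgebra.ι q m +
        algebraMap R (CliffordAlgebra q) ξ.1 * CliffordAlgebra.ι q m) +
        (CliffordAlgebra.ι q ξ.2 * CliffordAlgebra.ι q m +
          CliffordAlgebra.ι q m * CliffordAlgebra.ι q ξ.2) := by abel
      _ = 0 := by rw [h3, h4, add_zero]
  | mul a b ha hb => rw [← mul_assoc, ha, mul_assoc, hb, ← mul_assoc, map_mul]
  | add a b ha hb => rw [mul_add, ha, hb, map_add, add_mul]

theorem twistedConjEquiv_mem (q : QuadraticForm R M) [Module.Projective R M]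
    (α : paraCliffordGroup q) :
    twistedConjEquiv q α ∈ orthogonalGroupKernel (paraForm q) := by
  refine ⟨fun ξ => ?_, fun ξ hξ => ?_⟩
  · change paraForm q (twistedConj q α ξ) = paraForm q ξ
    refine algebraMap_injective q (neg_injective ?_)
    rw [← para_mul_involute, para_twistedConj]
    have h1 : CliffordAlgebra.involute
        (((gradeInv q α)⁻¹ : (CliffordAlgebra q)ˣ) : CliffordAlgebra q) =
        (((α : (CliffordAlgebra q)ˣ)⁻¹ : (CliffordAlgebra q)ˣ) : CliffordAlgebra q) := by
      rw [← map_inv, coe_gradeInv, CliffordAlgebra.involute_involute]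
    rw [map_mul, map_mul, h1, ← coe_gradeInv]
    calc _ = (α : (CliffordAlgebra q)ˣ) * para q ξ *
          ((((gradeInv q α)⁻¹ : (CliffordAlgebra q)ˣ) : CliffordAlgebra q) * gradeInv q α) *
          CliffordAlgebra.involute (para q ξ) *
          ((α : (CliffordAlgebra q)ˣ)⁻¹ : (CliffordAlgebra q)ˣ) := by simp only [mul_assoc]
      _ = (α : (CliffordAlgebra q)ˣ) * (para q ξ * CliffordAlgebra.involute (para q ξ)) *
          ((α : (CliffordAlgebra q)ˣ)⁻¹ : (CliffordAlgebra q)ˣ) := by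
        rw [Units.inv_mul, mul_one, mul_assoc _ (para q ξ)]
      _ = _ := by
        rw [para_mul_involute, mul_neg, ← Algebra.commutes, neg_mul, mul_assoc, Units.mul_inv,
          mul_one]
  · change twistedConj q α ξ = ξ
    refine para_injective q ?_
    rw [para_twistedConj, Units.mul_inv_eq_iff_eq_mul, para_mul_of_mem_kernel q hξ, coe_gradeInv,
      CliffordAlgebra.involute_involute]

/-- The homomorphism from the paravector Clifford group to `O_{M_R^⊥}(M_R, q_R)` taking `α` to
`ξ ↦ α ξ α'⁻¹`. -/
def paraPi (q : QuadraticForm R M) [Module.Projective R M] :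
    paraCliffordGroup q →* orthogonalGroupKernel (paraForm q) where
  toFun α := ⟨twistedConjEquiv q α, twistedConjEquiv_mem q α⟩
  map_one' := Subtype.ext (LinearEquiv.toLinearMap_injective (twistedConj_one q))
  map_mul' α β := Subtype.ext (LinearEquiv.toLinearMap_injective (twistedConj_mul q α β))

theorem para_paraPi (q : QuadraticForm R M) [Module.Projective R M] (α : paraCliffordGroup q)
    (ξ : R × M) :
    para q ((paraPi q α : (R × M) ≃ₗ[R] (R × M)) ξ) =
      (α : (CliffordAlgebra q)ˣ) * para q ξ * ((gradeInv q α)⁻¹ : (CliffordAlgebra q)ˣ) :=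
  para_twistedConj q α ξ

/-- The idempotent `e`, as an element of `e M_R = e (R ⊕ M)`. -/
def idemVec (e : R) (M : Type*) [AddCommGroup M] [Module R M] :
    idemPart e (R × M) :=
  ⟨(e, 0), (1, 0), by simp⟩

theorem isUnit_idemVec {e : R} (he : IsIdempotentElem e) (q : QuadraticForm R M) :
    IsUnit (idemForm he (paraForm q) (idemVec e M)) := by
  have : idemForm he (paraForm q) (idemVec e M) = -1 := Subtype.ext (by
    change paraForm q (e, 0) = -e
    rw [paraForm_apply, QuadraticMap.map_zero, zero_sub, he.pow_eq two_ne_zero])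
  rw [this]
  exact (isUnit_one (M := he.Corner)).neg

/-- The `e`-reflection `r_e` of `(M_R, q_R)` associated with `e ∈ R ⊆ M_R`. -/
def idemReflection {e : R} (he : IsIdempotentElem e) (q : QuadraticForm R M) :
    orthogonalGroupKernel (paraForm q) :=
  eReflection he (paraForm q) (idemVec e M) (isUnit_idemVec he q)

theorem idemReflection_apply {e : R} (he : IsIdempotentElem e) (q : QuadraticForm R M)
    (a : R) (x : M) :
    (idemReflection he q : (R × M) ≃ₗ[R] (R × M)) (a, x) = ((1 - 2 * e) * a, x) := by
  have h1 := inv_mul_apply he (paraForm q) (idemVec e M) (isUnit_idemVec he q)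
  have h2 : paraForm q (idemVec e M : R × M) = -e := by
    change paraForm q (e, 0) = -e
    rw [paraForm_apply, QuadraticMap.map_zero, zero_sub, he.pow_eq two_ne_zero]
  change eReflectionMap he (paraForm q) (idemVec e M) (isUnit_idemVec he q) (a, x) = _
  rw [eReflectionMap_apply, polar_paraForm]
  rw [h2] at h1
  generalize ((((isUnit_idemVec he q).unit⁻¹ : he.Cornerˣ) : he.Corner) : R) = w at *
  have h3 : ((idemVec e M : idemPart e (R × M)) : R × M) = (e, 0) := rfl
  have h4 := he.eq
  rw [h3]
  ext
  · simp
    linear_combination (-2 * e * a) * h1 - 2 * a * h4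
  · simp

end Paravector

end QuadMod

end

/-!
If `α` acts as the reflection `r_e`, then `α = (1 - 2e) α'` (action on `1`) and `α x = x α'` for
`x ∈ M`. After multiplication by `e` these become `α' = -α` and `α x = -x α`. They are transported
to a Clifford algebra over `S` by the map of `M` into the free module `S ^ J` that sends `m` to the
coordinates of `1 ⊗ e m` at the indices `J = {i | q (x i) ≠ 0}`. Since the basis is orthogonal,
dropping the isotropic basis vectors respects the quadratic forms, the form on `S ^ J` being the
diagonal one. So the image `β` of `α` is a unit of the Clifford algebra of a diagonal form with
regular entries `w j`.

There `ι v * β - β' * ι v` is the contraction of `β` by the linear form `polar Q v`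
(`contractLeft_polarBilin`), so `β` is annihilated by the contractions by `2 w j` times the `j`-th
coordinate form. Thus all coordinate forms annihilate `c β` for `c = ∏ 2 w j`, and an element
annihilated by all of them is a scalar (`mem_range_algebraMap_of_contractLeft_proj_eq_zero`).
A scalar is even while `β` is odd, so `2 c β = 0`, hence `2 c = 0` because `β` is a unit: this is
absurd, as `2 c` is regular in the non-zero ring `S`.
-/

section

open CliffordAlgebra

/-! ### Contractions in a Clifford algebra -/

/-- Contraction by the linear form `polar Q v` is the graded commutator with `v`. -/
theorem contractLeft_polarBilin {S V : Type*} [CommRing S] [AddCommGroup V] [Module S V]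
    (Q : QuadraticForm S V) (v : V) (β : CliffordAlgebra Q) :
    contractLeft (Q := Q) (QuadraticMap.polarBilin Q v) β =
      ι Q v * β - involute β * ι Q v := by
  induction β using CliffordAlgebra.left_induction with
  | algebraMap r => rw [contractLeft_algebraMap, AlgHom.commutes, Algebra.commutes, sub_self]
  | add x y hx hy => rw [map_add, hx, hy, map_add]; noncomm_ring
  | ι_mul x m hx =>
    have h := ι_mul_ι_add_swap (Q := Q) v m
    rw [contractLeft_ι_mul, hx, QuadraticMap.polarBilin_apply_apply, Algebra.smul_def, ← h,
      map_mul, involute_ι]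
    noncomm_ring

/-- An element of the Clifford algebra of `S ^ J` annihilated by the contractions by all coordinate
forms is a scalar. -/
theorem mem_range_algebraMap_of_contractLeft_proj_eq_zero {S J : Type*} [CommRing S] [Fintype J]
    [DecidableEq J] (Q : QuadraticForm S (J → S)) (β : CliffordAlgebra Q)
    (h : ∀ j, contractLeft (Q := Q) (LinearMap.proj j) β = 0) :
    ∃ t, β = algebraMap S (CliffordAlgebra Q) t := by
  -- `changeForm` commutes with contractions, which reduces the claim to the exterior algebra.
  obtain ⟨B, hB⟩ := QuadMod.exists_bilinForm (0 - Q)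
  suffices H : ∀ ω : CliffordAlgebra (0 : QuadraticForm S (J → S)),
      (∀ j, contractLeft (LinearMap.proj j) ω = 0) → ∃ t, ω = algebraMap S _ t by
    obtain ⟨t, ht⟩ := H (changeForm hB β) fun j => by
      rw [← changeForm_contractLeft, h, map_zero]
    refine ⟨t, (changeFormEquiv hB).injective ?_⟩
    change changeForm hB β = changeForm hB _
    rw [ht, changeForm_algebraMap]
  intro ω hω
  let b : J → CliffordAlgebra (0 : QuadraticForm S (J → S)) := fun j => ι _ (Pi.single j 1)
  -- The operator `P j` removes the monomials containing the `j`-th basis vector.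
  let P : J → CliffordAlgebra (0 : QuadraticForm S (J → S)) →ₗ[S] CliffordAlgebra 0 := fun j =>
    LinearMap.id - LinearMap.mulLeft S (b j) ∘ₗ contractLeft (LinearMap.proj j)
  have hP : ∀ j ω, P j ω = ω - b j * contractLeft (LinearMap.proj j) ω := fun j ω => rfl
  have hb : ∀ i j, b i * b j = -(b j * b i) := fun i j => by
    have := ι_mul_ι_add_swap (Q := (0 : QuadraticForm S (J → S))) (Pi.single i 1) (Pi.single j 1)
    rw [eq_neg_iff_add_eq_zero]
    refine this.trans ?_
    simp [QuadraticMap.polar]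
  have hbb : ∀ j, b j * b j = 0 := fun j =>
    (ι_sq_scalar (0 : QuadraticForm S (J → S)) (Pi.single j 1)).trans (map_zero _)
  have hPne : ∀ i j ω, i ≠ j → P i (b j * ω) = b j * P i ω := fun i j ω hij => by
    rw [hP, hP, contractLeft_ι_mul, LinearMap.proj_apply, Pi.single_eq_of_ne hij, zero_smul,
      zero_sub, mul_neg, sub_neg_eq_add, mul_sub, ← mul_assoc, ← mul_assoc, hb i j, neg_mul,
      sub_eq_add_neg]
  have hPeq : ∀ j ω, P j (b j * ω) = 0 := fun j ω => by
    rw [hP, contractLeft_ι_mul, LinearMap.proj_apply, Pi.single_eq_same, one_smul, mul_sub,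
      ← mul_assoc, hbb, zero_mul, sub_zero, sub_self]
  have hPs : ∀ j t, P j (algebraMap S _ t) = algebraMap S _ t := fun j t => by
    rw [hP, contractLeft_algebraMap, mul_zero, sub_zero]
  -- Composing the operators `P j` over a list `l` of indices.
  let F : List J → CliffordAlgebra (0 : QuadraticForm S (J → S)) →ₗ[S] CliffordAlgebra 0 :=
    fun l => (l.map P).prod
  have hFcons : ∀ i l ω, F (i :: l) ω = P i (F l ω) := fun i l ω => rfl
  have hFs : ∀ l t, F l (algebraMap S _ t) = algebraMap S _ t := fun l t => by
    induction l with
    | nil => rfl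
    | cons i l ih => rw [hFcons, ih, hPs]
  have hFb : ∀ l j, j ∉ l → ∀ ω, F l (b j * ω) = b j * F l ω := fun l j hj ω => by
    induction l with
    | nil => rfl
    | cons i l ih =>
      rw [List.mem_cons, not_or] at hj
      rw [hFcons, hFcons, ih hj.2, hPne _ _ _ (Ne.symm hj.1)]
  have hFk : ∀ l j, j ∈ l → ∀ ω, F l (b j * ω) = 0 := fun l j hj ω => by
    induction l with
    | nil => simp at hj
    | cons i l ih =>
      by_cases hjl : j ∈ l
      · rw [hFcons, ih hjl, map_zero]
      · obtain rfl : j = i := (List.mem_cons.mp hj).resolve_right hjl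
        rw [hFcons, hFb _ _ hjl, hPeq]
  have key : ∀ ω, ∃ t, F Finset.univ.toList ω = algebraMap S _ t := fun ω => by
    induction ω using CliffordAlgebra.left_induction with
    | algebraMap r => exact ⟨r, hFs _ _⟩
    | add x y hx hy =>
      obtain ⟨s, hs⟩ := hx
      obtain ⟨t, ht⟩ := hy
      exact ⟨s + t, by rw [map_add, hs, ht, map_add]⟩
    | ι_mul x m hx =>
      refine ⟨0, ?_⟩
      have hm : ι (0 : QuadraticForm S (J → S)) m = ∑ j, m j • b j := by
        conv_lhs => rw [pi_eq_sum_univ' m]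
        simp only [map_sum, map_smul, b]
      rw [hm, Finset.sum_mul, map_sum, map_zero]
      refine Finset.sum_eq_zero fun j _ => ?_
      rw [smul_mul_assoc, map_smul, hFk _ _ (by simp), smul_zero]
  obtain ⟨t, ht⟩ := key ω
  have hfix : ∀ l, F l ω = ω := fun l => by
    induction l with
    | nil => rfl
    | cons i l ih => rw [hFcons, ih, hP, hω, mul_zero, sub_zero]
  exact ⟨t, (hfix _).symm.trans ht⟩

/-! ### Diagonal forms with regular entries -/

theorem polar_weightedSumSquares_single {S J : Type*} [CommRing S] [Fintype J] [DecidableEq J]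
    (w : J → S) (j : J) :
    QuadraticMap.polarBilin (QuadraticMap.weightedSumSquares S w) (Pi.single j 1) =
      (2 * w j) • LinearMap.proj j := by
  refine LinearMap.ext fun v => ?_
  simp only [QuadraticMap.polarBilin_apply_apply, QuadraticMap.polar,
    QuadraticMap.weightedSumSquares_apply, ← Finset.sum_sub_distrib, LinearMap.smul_apply,
    LinearMap.proj_apply, smul_eq_mul]
  rw [Finset.sum_eq_single j (fun i _ hi => by simp [Pi.single_eq_of_ne hi]) (by simp)]
  simp only [Pi.add_apply, Pi.single_eq_same]
  ring

/-- Over a non-zero ring in which `2` is regular, no unit of the Clifford algebra of a diagonal form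
with regular entries is odd and anticommutes with all vectors. -/
theorem not_isUnit_of_anticommute {S J : Type*} [CommRing S] [Nontrivial S] [Fintype J]
    [DecidableEq J] (w : J → S) (h2 : (2 : S) ∈ nonZeroDivisors S)
    (hw : ∀ j, w j ∈ nonZeroDivisors S)
    (β : CliffordAlgebra (QuadraticMap.weightedSumSquares S w)) (hodd : involute β = -β)
    (hcomm : ∀ v, β * ι _ v = ι _ v * involute β) : ¬ IsUnit β := by
  intro hβ
  have h1 : ∀ j, (2 * w j) • contractLeft (LinearMap.proj j) β = 0 := fun j => by
    have h := contractLeft_polarBilin (QuadraticMap.weightedSumSquares S w) (Pi.single j 1) β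
    rw [polar_weightedSumSquares_single, map_smul, LinearMap.smul_apply] at h
    rw [h, hodd, neg_mul, hcomm, hodd, mul_neg, neg_neg, sub_self]
  -- One scalar multiple of `β` is annihilated by all coordinate forms at once, so that nothing is
  -- needed about torsion in the Clifford algebra.
  obtain ⟨t, ht⟩ := mem_range_algebraMap_of_contractLeft_proj_eq_zero _ ((∏ j, 2 * w j) • β)
    fun j => by
      rw [map_smul, ← Finset.prod_erase_mul _ _ (Finset.mem_univ j), mul_smul, h1, smul_zero]
  have h3 : (2 * ∏ j, 2 * w j) • β = 0 := by
    have h := congrArg involute ht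
    rw [map_smul, hodd, AlgHom.commutes, ← ht, smul_neg] at h
    rw [mul_smul, two_smul]
    nth_rewrite 1 [← h]
    exact neg_add_cancel _
  have h4 : (2 * ∏ j, 2 * w j : S) = 0 := by
    refine QuadMod.algebraMap_injective (QuadraticMap.weightedSumSquares S w) ?_
    rw [map_zero, ← hβ.mul_left_eq_zero, ← Algebra.smul_def, h3]
  refine nonZeroDivisors.ne_zero (mul_mem h2 (prod_mem fun j _ => mul_mem h2 (hw j))) h4

/-- The value of a quadratic form in terms of coordinates in an orthogonal basis; only the basis
vectors on which the form does not vanish contribute. -/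
theorem weightedSumSquares_repr_of_orthogonal {S V : Type*} [CommRing S] [AddCommGroup V]
    [Module S V] {n : ℕ} (x : Module.Basis (Fin n) S V) (Q : QuadraticForm S V)
    (hx : ∀ i j, i ≠ j → QuadraticMap.polar Q (x i) (x j) = 0)
    [Fintype {i // Q (x i) ≠ 0}] (z : V) :
    QuadraticMap.weightedSumSquares S (fun j : {i // Q (x i) ≠ 0} => Q (x j))
      (fun j => x.repr z j) = Q z := by
  classical
  have hsum : ∀ s : Finset (Fin n), Q (∑ i ∈ s, x.repr z i • x i) =
      ∑ i ∈ s, Q (x i) * (x.repr z i * x.repr z i) := fun s => by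
    induction s using Finset.induction_on with
    | empty => simp
    | insert i s his ih =>
      have hp : QuadraticMap.polar Q (x.repr z i • x i) (∑ j ∈ s, x.repr z j • x j) = 0 := by
        rw [← QuadraticMap.polarBilin_apply_apply, map_sum]
        refine Finset.sum_eq_zero fun j hj => ?_
        rw [QuadraticMap.polarBilin_apply_apply, QuadraticMap.polar_smul_left,
          QuadraticMap.polar_smul_right, hx i j (fun h => his (h ▸ hj)), smul_zero, smul_zero]
      rw [Finset.sum_insert his, Finset.sum_insert his, QuadraticMap.map_add Q, hp, ih,
        QuadraticMap.map_smul, add_zero, smul_eq_mul, mul_comm]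
  conv_rhs => rw [← x.sum_repr z, hsum]
  rw [QuadraticMap.weightedSumSquares_apply]
  simp only [smul_eq_mul]
  rw [← Finset.sum_subtype (Finset.univ.filter fun i => Q (x i) ≠ 0) (by simp)
    (fun i => Q (x i) * (x.repr z i * x.repr z i))]
  exact Finset.sum_filter_of_ne fun i _ h h0 => h (by rw [h0, zero_mul])

/-! ### Change of the base ring -/

/-- A map `f` from `M` to `S ^ J` that is compatible with the quadratic forms and has spanning image
induces a homomorphism of Clifford algebras, along which `not_isUnit_of_anticommute` applies. -/
theorem not_anticommute_of_isometry {R S M J : Type*} [CommRing R] [CommRing S] [Nontrivial S]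
    [Algebra R S] [AddCommGroup M] [Module R M] [Fintype J] [DecidableEq J]
    (q : QuadraticForm R M) (w : J → S) (h2 : (2 : S) ∈ nonZeroDivisors S)
    (hw : ∀ j, w j ∈ nonZeroDivisors S) (f : M →ₗ[R] J → S)
    (hf : ∀ m, QuadraticMap.weightedSumSquares S w (f m) = algebraMap R S (q m))
    (hspan : Submodule.span S (Set.range f) = ⊤)
    (α : (CliffordAlgebra q)ˣ) (c : R) (hc : algebraMap R S c = -1)
    (hα : (α : CliffordAlgebra q) = c • involute (α : CliffordAlgebra q)) :
    ¬ ∀ m, (α : CliffordAlgebra q) * ι q m = ι q m * involute (α : CliffordAlgebra q) := by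
  intro hcomm
  let Q := QuadraticMap.weightedSumSquares S w
  let φ : CliffordAlgebra q →ₐ[R] CliffordAlgebra Q :=
    lift q ⟨(ι Q).restrictScalars R ∘ₗ f, fun m => by
      rw [LinearMap.comp_apply, LinearMap.restrictScalars_apply, ι_sq_scalar, hf,
        ← IsScalarTower.algebraMap_apply]⟩
  have hφ : ∀ m, φ (ι q m) = ι Q (f m) := fun m => lift_ι_apply _ _ _
  have hinv : ∀ a, φ (involute a) = involute (φ a) := fun a => by
    induction a using CliffordAlgebra.induction with
    | algebraMap r =>
      rw [AlgHom.commutes, AlgHom.commutes, IsScalarTower.algebraMap_apply R S, AlgHom.commutes]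
    | ι m => rw [involute_ι, map_neg, hφ, involute_ι]
    | mul a b ha hb => rw [map_mul, map_mul, ha, hb, map_mul, map_mul]
    | add a b ha hb => rw [map_add, map_add, ha, hb, map_add, map_add]
  refine not_isUnit_of_anticommute w h2 hw (φ α) ?_ (fun v => ?_) (α.isUnit.map φ)
  · have h := congrArg φ hα
    rw [map_smul, hinv, ← algebraMap_smul S c, hc, neg_smul, one_smul] at h
    rw [h, neg_neg, ← h]
  · have hv : v ∈ Submodule.span S (Set.range f) := hspan ▸ Submodule.mem_top
    induction hv using Submodule.span_induction with
    | mem v hv =>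
      obtain ⟨m, rfl⟩ := hv
      rw [← hφ, ← hinv, ← map_mul, ← map_mul, hcomm]
    | zero => rw [map_zero, mul_zero, zero_mul]
    | add v v' _ _ h h' => rw [map_add, mul_add, h, h', add_mul]
    | smul s v _ h => rw [map_smul, mul_smul_comm, h, smul_mul_assoc]

/-- The equation `α ξ α'⁻¹ = r_e ξ` evaluated at `ξ = 1` and at `ξ ∈ M`. -/
theorem twisted_comm_of_paraPi_eq {R M : Type*} [CommRing R] [AddCommGroup M] [Module R M]
    [Module.Projective R M] (q : QuadraticForm R M) {e : R} (he : IsIdempotentElem e)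
    (α : QuadMod.paraCliffordGroup q) (h : QuadMod.paraPi q α = QuadMod.idemReflection he q) :
    ((α : (CliffordAlgebra q)ˣ) : CliffordAlgebra q) =
      (1 - 2 * e) • involute ((α : (CliffordAlgebra q)ˣ) : CliffordAlgebra q) ∧
    ∀ m, ((α : (CliffordAlgebra q)ˣ) : CliffordAlgebra q) * ι q m =
      ι q m * involute ((α : (CliffordAlgebra q)ˣ) : CliffordAlgebra q) := by
  have key : ∀ a m, QuadMod.para q ((1 - 2 * e) * a, m) *
      involute ((α : (CliffordAlgebra q)ˣ) : CliffordAlgebra q) =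
      ((α : (CliffordAlgebra q)ˣ) : CliffordAlgebra q) * QuadMod.para q (a, m) := fun a m => by
    rw [← QuadMod.idemReflection_apply he q, ← h, QuadMod.para_paraPi, ← QuadMod.coe_gradeInv,
      Units.inv_mul_cancel_right]
  refine ⟨?_, fun m => ?_⟩
  · have := key 1 0
    simp only [QuadMod.para_apply, map_zero, add_zero, mul_one, map_one] at this
    exact this.symm.trans (Algebra.smul_def _ _).symm
  · have := key 0 m
    simp only [QuadMod.para_apply, map_zero, zero_add, mul_zero] at this
    exact this.symm

end

theorem mainTheorem4 {R : Type*} [CommRing R] {M : Type*} [AddCommGroup M] [Module R M]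
    [Module.Finite R M] [Module.Projective R M] (q : QuadraticForm R M)
    {e : R} (he : IsIdempotentElem e) (he0 : e ≠ 0)
    {S : Type*} [CommRing S] [Algebra he.Corner S]
    (hS : Function.Injective (algebraMap he.Corner S))
    {n : ℕ} (x : Module.Basis (Fin n) S (S ⊗[he.Corner] QuadMod.idemPart e M))
    (hx : ∀ i j, i ≠ j →
      QuadraticMap.polar (QuadMod.extend S (QuadMod.idemForm he q)) (x i) (x j) = 0)
    (h2 : (2 : S) ∈ nonZeroDivisors S)
    (hq : ∀ i, QuadMod.extend S (QuadMod.idemForm he q) (x i) ≠ 0 →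
      QuadMod.extend S (QuadMod.idemForm he q) (x i) ∈ nonZeroDivisors S) :
    QuadMod.idemReflection he q ∉ (QuadMod.paraPi q).range := by
  classical
  rintro ⟨α, hα⟩
  obtain ⟨h1, hcomm⟩ := twisted_comm_of_paraPi_eq q he α hα
  have : Nontrivial he.Corner := ⟨1, 0, fun h => he0 (congrArg Subtype.val h)⟩
  have : Nontrivial S := hS.nontrivial
  -- `S` becomes an `R`-algebra through `R → eR → S`, so `1 - 2e` acts on it as `-1`.
  let _ : Algebra R S := ((algebraMap he.Corner S).comp (QuadMod.toCorner he)).toAlgebra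
  have hmap : ∀ r, algebraMap R S r = algebraMap he.Corner S (QuadMod.toCorner he r) :=
    fun _ => rfl
  let Q := QuadMod.extend S (QuadMod.idemForm he q)
  let J := {i // Q (x i) ≠ 0}
  let g : S ⊗[he.Corner] QuadMod.idemPart e M →ₗ[S] J → S :=
    LinearMap.funLeft S S (Subtype.val : J → Fin n) ∘ₗ x.equivFun.toLinearMap
  let p : M → QuadMod.idemPart e M := fun m => ⟨e • m, m, rfl⟩
  let f : M →ₗ[R] J → S :=
    { toFun := fun m => g (1 ⊗ₜ p m)
      map_add' := fun m m' => by
        rw [← map_add, ← TensorProduct.tmul_add]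
        congr 2
        exact Subtype.ext (smul_add e m m')
      map_smul' := fun r m => by
        have hp : p (r • m) = QuadMod.toCorner he r • p m := Subtype.ext (by
          change e • r • m = (e * r) • e • m
          rw [smul_smul, smul_smul, mul_right_comm, he.eq])
        have ht : (1 : S) ⊗ₜ[he.Corner] p (r • m) = algebraMap R S r • (1 ⊗ₜ p m) := by
          rw [hp, ← TensorProduct.smul_tmul, TensorProduct.smul_tmul', Algebra.smul_def, hmap,
            smul_eq_mul]
        rw [ht, map_smul, algebraMap_smul, RingHom.id_apply] }
  refine not_anticommute_of_isometry q (fun j : J => Q (x j)) h2 (fun j => hq j j.2) f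
    (fun m => ?_) ?_ α (1 - 2 * e) ?_ h1 hcomm
  · rw [hmap]
    refine (weightedSumSquares_repr_of_orthogonal x Q hx (1 ⊗ₜ p m)).trans ?_
    rw [QuadMod.extend_tmul, one_pow, one_mul]
    refine congrArg _ (Subtype.ext ?_)
    change q (e • m) = e * q m
    rw [QuadraticMap.map_smul, he.eq, smul_eq_mul]
  · have hg : Function.Surjective g :=
      (LinearMap.funLeft_surjective_of_injective S S _ Subtype.val_injective).comp
        x.equivFun.surjective
    refine Submodule.eq_top_iff'.mpr fun v => ?_
    obtain ⟨z, rfl⟩ := hg v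
    induction z with
    | zero => rw [map_zero]; exact zero_mem _
    | add a b ha hb => rw [map_add]; exact add_mem ha hb
    | tmul s y =>
      have hy : p y = y := Subtype.ext (QuadMod.smul_of_mem_idemPart he y.2)
      have hs : g (s ⊗ₜ y) = s • f y := by
        change _ = s • g (1 ⊗ₜ p y)
        rw [hy, ← map_smul, TensorProduct.smul_tmul', smul_eq_mul, mul_one]
      rw [hs]
      exact Submodule.smul_mem _ _ (Submodule.subset_span ⟨_, rfl⟩)
  · have he' : QuadMod.toCorner he (1 - 2 * e) = -1 := Subtype.ext (by
      change e * (1 - 2 * e) = -e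
      linear_combination (-2 : R) * he.eq)
    rw [hmap, he', map_neg, map_one]
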